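/- An ordered graph on $n$ vertices is a simple graph together with a linear order on its (finite) vertex set, which is identified, respecting the order, with $[n]=\{1,\dots,n\}$. A hereditary property of ordered graphs is a collection $\mathcal{P}$ of ordered graphs that is closed under taking induced ordered subgraphs (with the inherited order, again relabelled order-preservingly by an initial segment of $\mathbb{N}$). Write $\mathcal{P}_n$ for the set of ordered graphs in $\mathcal{P}$ with vertex set $[n]$. Theorem. Let $\mathcal{P}$ be a hereditary property of ordered graphs. If $|\mathcal{P}_k| < k$ for some $k \geqslant 136$, then $|\mathcal{P}_n| \leqslant |\mathcal{P}_k|$ for every $n \geqslant k$. Moreover, the function $n \mapsto |\mathcal{P}_n|$ is non-increasing on $\{k, k+1, \dots\}$, that is, $|\mathcal{P}_n| \leqslant |\mathcal{P}_m|$ whenever $n \geqslant m \geqslant k$. -/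

import Mathlib

/-- A (finite) ordered graph: a simple graph whose linearly ordered vertex set is identified, by the
unique order isomorphism, with `Fin n`, where `n` is the number of vertices. -/
structure OrderedGraph where
  /-- the number of vertices -/
  order : ℕ
  /-- the graph on the vertex set `Fin order`, which carries its usual linear order -/
  graph : SimpleGraph (Fin order)

namespace OrderedGraph

/-- `H` is (after the order-preserving identification of its vertex set with an initial segment of
the natural numbers) an induced ordered subgraph of `G`. -/
def IsInducedSubgraph (H G : OrderedGraph) : Prop :=
  ∃ f : Fin H.order ↪o Fin G.order, ∀ u v, H.graph.Adj u v ↔ G.graph.Adj (f u) (f v)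

/-- A collection of ordered graphs is hereditary if it is closed under taking induced ordered
subgraphs. -/
def IsHereditary (P : Set OrderedGraph) : Prop :=
  ∀ ⦃G H : OrderedGraph⦄, G ∈ P → H.IsInducedSubgraph G → H ∈ P

/-- The collection of those graphs on the vertex set `Fin n` that belong to `P`. -/
def level (P : Set OrderedGraph) (n : ℕ) : Set (SimpleGraph (Fin n)) :=
  {G | (⟨n, G⟩ : OrderedGraph) ∈ P}

/-- The speed of `P`: the number of members of `P` with vertex set `Fin n`. -/
noncomputable def speed (P : Set OrderedGraph) (n : ℕ) : ℕ :=
  (level P n).ncard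

end OrderedGraph

/-!
Give each member `G` of a family `F` of graphs on `n + 1` ordered vertices a set `B G` of forbidden
vertices. If `∑ G ∈ F, (#(B G) + 1) ≤ n`, then deleting single allowed vertices from the members of
`F` yields at least `#F` graphs; for `B = ∅` this says that the speed cannot increase once it is
below `n`. Forbidden vertices make an induction on `n` possible. Group `F` into fibres according to
the graph `K` induced on all but the last vertex. Deleting a vertex `u` of `K` is injective on the
fibre of `K` unless `u` is an essential coordinate of the last rows, and by Bondy's theorem there
are fewer essential coordinates than extensions of `K`. Hence forbidding them in `K`, together with
the vertices forbidden in some extension, does not increase the total weight, and if the initial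
parts satisfy Hall's condition, then so many deletions lift to `F` that the claim follows.

Otherwise all inequalities used are equalities. Then all fibres have the same size, at least two,
and all deletions of an essential vertex from an initial part give the same graph. Two initial
parts that agree after deletion of an allowed vertex `p` share an essential vertex `c`, so they
also agree after deletion of `c`, and they differ exactly in the edge `pc`. Thus every vertex `p`
allowed in all initial parts provides an essential coordinate of their edge sets, and Bondy's
theorem contradicts the bound on the weight.
-/

open Finset

section Bondy

variable {β ι : Type*} {α : ι → Type*}

/-- The coordinate `s` is essential for the family `(f x)` with `x ∈ X` if forgetting it identifies
two distinct members of the family. -/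
def IsEssentialCoord (f : β → ∀ i, α i) (X : Finset β) (s : ι) : Prop :=
  ∃ x ∈ X, ∃ y ∈ X, f x s ≠ f y s ∧ ∀ i ≠ s, f x i = f y i

open Classical in
theorem IsEssentialCoord.update {f : β → ∀ i, α i} {X : Finset β} {s b : ι}
    (hs : IsEssentialCoord f X s) (hsb : s ≠ b) (c : α b) :
    IsEssentialCoord (fun x => Function.update (f x) b c) X s := by
  obtain ⟨x, hx, y, hy, hne, hag⟩ := hs
  refine ⟨x, hx, y, hy, by simpa [hsb] using hne, fun i hi => ?_⟩
  by_cases hib : i = b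
  · subst hib
    simp
  · simpa [hib] using hag i hi

open Classical in
theorem IsEssentialCoord.card_image_update_lt {f : β → ∀ i, α i} {X : Finset β} {b : ι}
    (hb : IsEssentialCoord f X b) (c : α b) :
    #(X.image fun x => Function.update (f x) b c) < #(X.image f) := by
  have himage : (X.image fun x => Function.update (f x) b c) =
      (X.image f).image fun w => Function.update w b c := by
    rw [image_image]
    rfl
  rw [himage]
  refine lt_of_le_of_ne card_image_le fun hcard => ?_
  obtain ⟨x, hx, y, hy, hne, hag⟩ := hb
  have hupdate : Function.update (f x) b c = Function.update (f y) b c :=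
    Function.update_eq_iff.2 ⟨by simp, fun i hi => by simpa [hi] using hag i hi⟩
  exact hne <| congrFun (card_image_iff.1 hcard (mem_coe.2 (mem_image_of_mem f hx))
    (mem_coe.2 (mem_image_of_mem f hy)) hupdate) b

-- This is Bondy's theorem on induced subsets.
theorem card_lt_card_of_isEssentialCoord {f : β → ∀ i, α i} {X : Finset β} (hX : X.Nonempty)
    {S : Finset ι} (hS : ∀ s ∈ S, IsEssentialCoord f X s) : #S < #X := by
  classical
  suffices h : #S < #(X.image f) from h.trans_le card_image_le
  have ⟨x₀, _⟩ := hX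
  induction S using Finset.induction_on generalizing f with
  | empty => simpa using hX
  | insert b S hb ih =>
    have hlt := (hS b (mem_insert_self b S)).card_image_update_lt (f x₀ b)
    have hrec := ih fun s hs =>
      (hS s (mem_insert_of_mem hs)).update (ne_of_mem_of_not_mem hs hb) (f x₀ b)
    rw [card_insert_of_notMem hb]
    omega

theorem card_lt_card_of_isEssentialCoord_edge {V : Type*} {α : Sym2 V → Type*}
    {f : β → ∀ e, α e} {X : Finset β} (hX : X.Nonempty) {U : Finset V}
    (hU : ∀ p ∈ U, ∃ c ∉ U, IsEssentialCoord f X s(p, c)) : #U < #X := by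
  classical
  choose! c hcU hess using hU
  have hinj : Set.InjOn (fun p => s(p, c p)) U := by
    intro p hp q hq hpq
    rcases Sym2.eq_iff.1 hpq with ⟨h, -⟩ | ⟨h, -⟩
    · exact h
    · exact absurd (h ▸ hp) (hcU q hq)
  rw [← card_image_of_injOn hinj]
  exact card_lt_card_of_isEssentialCoord hX (forall_mem_image.2 hess)

end Bondy

theorem sum_le_sum_biUnion_of_hall {ι α M : Type*} [DecidableEq α] [AddCommMonoid M]
    [PartialOrder M] [IsOrderedAddMonoid M] [CanonicallyOrderedAdd M] {s : Finset ι}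
    {t : ι → Finset α} (hall : ∀ r ⊆ s, #r ≤ #(r.biUnion t)) {f : ι → M} {g : α → M}
    (hfg : ∀ i ∈ s, ∀ a ∈ t i, f i ≤ g a) : ∑ i ∈ s, f i ≤ ∑ a ∈ s.biUnion t, g a := by
  classical
  obtain ⟨φ, hφ, hφt⟩ :=
    (all_card_le_biUnion_card_iff_exists_injective fun i : s => t i).1 fun r => by
      have hr := hall (r.image Subtype.val) (image_subset_iff.2 fun i _ => i.2)
      rwa [card_image_of_injective _ Subtype.val_injective, image_biUnion] at hr
  calc ∑ i ∈ s, f i = ∑ i : s, f i := (sum_coe_sort s f).symm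
    _ ≤ ∑ i : s, g (φ i) := sum_le_sum fun i _ => hfg i i.2 _ (hφt i)
    _ = ∑ a ∈ univ.image φ, g a := (sum_image hφ.injOn).symm
    _ ≤ ∑ a ∈ s.biUnion t, g a := sum_le_sum_of_subset <| image_subset_iff.2 fun i _ =>
        mem_biUnion.2 ⟨i, i.2, hφt i⟩

namespace OrderedGraph

section DeleteVertex

variable {n : ℕ}

/-- The graph obtained by deleting the vertex `v`, with the remaining vertices relabelled in
increasing order. -/
def deleteVertex (G : SimpleGraph (Fin (n + 1))) (v : Fin (n + 1)) : SimpleGraph (Fin n) :=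
  G.comap v.succAbove

/-- The adjacencies of the last vertex, as a vector indexed by the other vertices. -/
def lastRow (G : SimpleGraph (Fin (n + 1))) (x : Fin n) : Prop :=
  G.Adj x.castSucc (Fin.last n)

theorem deleteVertex_adj (G : SimpleGraph (Fin (n + 1))) (v : Fin (n + 1)) (x y : Fin n) :
    (deleteVertex G v).Adj x y ↔ G.Adj (v.succAbove x) (v.succAbove y) := Iff.rfl

theorem adj_iff_of_deleteVertex_eq {G H : SimpleGraph (Fin (n + 1))} {v : Fin (n + 1)}
    (h : deleteVertex G v = deleteVertex H v) {x y : Fin (n + 1)} (hx : x ≠ v) (hy : y ≠ v) :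
    G.Adj x y ↔ H.Adj x y := by
  obtain ⟨x, rfl⟩ := Fin.exists_succAbove_eq hx
  obtain ⟨y, rfl⟩ := Fin.exists_succAbove_eq hy
  rw [← deleteVertex_adj, h, deleteVertex_adj]

theorem mem_edgeSet_iff_of_deleteVertex_eq {G H : SimpleGraph (Fin (n + 1))} {p c : Fin (n + 1)}
    (hpc : p ≠ c) (hp : deleteVertex G p = deleteVertex H p)
    (hc : deleteVertex G c = deleteVertex H c) {e : Sym2 (Fin (n + 1))} (he : e ≠ s(p, c)) :
    e ∈ G.edgeSet ↔ e ∈ H.edgeSet := by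
  induction e using Sym2.ind with
  | _ x y =>
    simp only [SimpleGraph.mem_edgeSet]
    by_cases hxy : x = y
    · simp [hxy]
    by_cases hp' : x ≠ p ∧ y ≠ p
    · exact adj_iff_of_deleteVertex_eq hp hp'.1 hp'.2
    · refine adj_iff_of_deleteVertex_eq hc ?_ ?_ <;> grind

theorem eq_of_deleteVertex_last_eq {G H : SimpleGraph (Fin (n + 1))}
    (h : deleteVertex G (Fin.last n) = deleteVertex H (Fin.last n)) (hrow : lastRow G = lastRow H) :
    G = H := by
  ext x y
  induction x using Fin.lastCases with
  | last =>
    induction y using Fin.lastCases with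
    | last => simp
    | cast y => rw [G.adj_comm, H.adj_comm]; exact iff_of_eq (congrFun hrow y)
  | cast x =>
    induction y using Fin.lastCases with
    | last => exact iff_of_eq (congrFun hrow x)
    | cast y =>
      exact adj_iff_of_deleteVertex_eq h (Fin.castSucc_ne_last x) (Fin.castSucc_ne_last y)

theorem deleteVertex_castSucc_deleteVertex_last (G : SimpleGraph (Fin (n + 2))) (u : Fin (n + 1)) :
    deleteVertex (deleteVertex G u.castSucc) (Fin.last n) =
      deleteVertex (deleteVertex G (Fin.last (n + 1))) u := by
  ext x y
  simp [deleteVertex_adj]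

theorem lastRow_deleteVertex_castSucc (G : SimpleGraph (Fin (n + 2))) (u : Fin (n + 1))
    (x : Fin n) : lastRow (deleteVertex G u.castSucc) x = lastRow G (u.succAbove x) := by
  simp [lastRow, deleteVertex_adj]

end DeleteVertex

section Weight

variable {β V : Type*}

/-- The weight of a finite family `F` in which `B x` is the set of forbidden vertices of `x`: each
member counts for one more than the number of its forbidden vertices. -/
def weight (F : Finset β) (B : β → Finset V) : ℕ :=
  ∑ x ∈ F, (#(B x) + 1)

theorem weight_eq (F : Finset β) (B : β → Finset V) : weight F B = ∑ x ∈ F, #(B x) + #F := by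
  simp [weight, sum_add_distrib]

theorem weight_lt_weight_of_ssubset {F Y : Finset β} (hY : Y ⊂ F) (B : β → Finset V) :
    weight Y B < weight F B := by
  obtain ⟨x, hx, hxY⟩ := exists_of_ssubset hY
  exact sum_lt_sum_of_subset hY.1 hx hxY (Nat.succ_pos _) fun _ _ _ => Nat.zero_le _

theorem weight_update_erase_lt [DecidableEq β] [DecidableEq V] {F : Finset β} {B : β → Finset V}
    {x : β} (hx : x ∈ F) {b : V} (hb : b ∈ B x) :
    weight F (Function.update B x ((B x).erase b)) < weight F B := by
  refine sum_lt_sum (fun y _ => ?_) ⟨x, hx, by simpa using card_erase_lt_of_mem hb⟩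
  by_cases hy : y = x
  · subst hy
    simpa using card_erase_le
  · simp [hy]

theorem card_le_card_compl_biUnion_of_weight_le [Fintype V] [DecidableEq V] {F : Finset β}
    {B : β → Finset V} (h : weight F B ≤ Fintype.card V) : #F ≤ #(F.biUnion B)ᶜ := by
  have hunion : #(F.biUnion B) ≤ ∑ x ∈ F, #(B x) := card_biUnion_le
  have hcompl := card_add_card_compl (F.biUnion B)
  rw [weight_eq] at h
  omega

end Weight

section Shadow

variable {n : ℕ}

open Classical in
/-- The shadow of a family `F` of graphs: all graphs obtained from a member `G` of `F` by deleting
a vertex that is not in the set `B G` of forbidden vertices. -/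
noncomputable def shadow (F : Finset (SimpleGraph (Fin (n + 1))))
    (B : SimpleGraph (Fin (n + 1)) → Finset (Fin (n + 1))) : Finset (SimpleGraph (Fin n)) :=
  F.biUnion fun G => (B G)ᶜ.image (deleteVertex G)

/-- Hall's condition for matching each member of `F` to an element of its shadow. -/
def HallCondition (F : Finset (SimpleGraph (Fin (n + 1))))
    (B : SimpleGraph (Fin (n + 1)) → Finset (Fin (n + 1))) : Prop :=
  ∀ Y ⊆ F, #Y ≤ #(shadow Y B)

variable {F Y : Finset (SimpleGraph (Fin (n + 1)))}
  {B : SimpleGraph (Fin (n + 1)) → Finset (Fin (n + 1))} {K : SimpleGraph (Fin (n + 1))}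

theorem mem_shadow {S : SimpleGraph (Fin n)} :
    S ∈ shadow F B ↔ ∃ G ∈ F, ∃ v ∉ B G, deleteVertex G v = S := by
  simp [shadow]

theorem deleteVertex_mem_shadow {G : SimpleGraph (Fin (n + 1))} (hG : G ∈ F) {v : Fin (n + 1)}
    (hv : v ∉ B G) : deleteVertex G v ∈ shadow F B :=
  mem_shadow.2 ⟨G, hG, v, hv, rfl⟩

theorem shadow_mono (h : Y ⊆ F) (B : SimpleGraph (Fin (n + 1)) → Finset (Fin (n + 1))) :
    shadow Y B ⊆ shadow F B := by
  classical
  exact biUnion_subset_biUnion_of_subset_left _ h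

open Classical in
theorem shadow_update_erase_subset (F : Finset (SimpleGraph (Fin (n + 1))))
    (B : SimpleGraph (Fin (n + 1)) → Finset (Fin (n + 1))) (K : SimpleGraph (Fin (n + 1)))
    (b : Fin (n + 1)) :
    shadow F (Function.update B K ((B K).erase b)) ⊆ insert (deleteVertex K b) (shadow F B) := by
  intro S hS
  obtain ⟨J, hJ, v, hv, rfl⟩ := mem_shadow.1 hS
  rw [mem_insert, or_iff_not_imp_left]
  intro hne
  refine deleteVertex_mem_shadow hJ fun hvJ => hv ?_
  by_cases hJK : J = K
  · subst hJK
    simpa [hvJ] using fun hvb : v = b => hne (by rw [hvb])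
  · simpa [hJK] using hvJ

/-- A family with a shadow too small for its members to be matched to it, all families of smaller
weight having large enough shadows. -/
structure IsMinimalDeficient (F : Finset (SimpleGraph (Fin (n + 1))))
    (B : SimpleGraph (Fin (n + 1)) → Finset (Fin (n + 1))) : Prop where
  card_shadow_lt : #(shadow F B) < #F
  card_le_card_shadow : ∀ (Y : Finset (SimpleGraph (Fin (n + 1))))
    (C : SimpleGraph (Fin (n + 1)) → Finset (Fin (n + 1))),
    weight Y C < weight F B → #Y ≤ #(shadow Y C)

namespace IsMinimalDeficient

theorem of_not_hallCondition (h : ¬ HallCondition F B)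
    (hmin : ∀ (Y : Finset (SimpleGraph (Fin (n + 1))))
      (C : SimpleGraph (Fin (n + 1)) → Finset (Fin (n + 1))),
      weight Y C < weight F B → #Y ≤ #(shadow Y C)) : IsMinimalDeficient F B := by
  refine ⟨?_, hmin⟩
  by_contra! hF
  refine h fun Y hY => ?_
  rcases hY.eq_or_ssubset with rfl | hY
  · exact hF
  · exact hmin Y B (weight_lt_weight_of_ssubset hY B)

theorem hallCondition_of_ssubset (h : IsMinimalDeficient F B) (hY : Y ⊂ F) : HallCondition Y B :=
  fun _ hZ => h.card_le_card_shadow _ B (weight_lt_weight_of_ssubset (hZ.trans_ssubset hY) B)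

theorem card_eq_card_shadow_add_one (h : IsMinimalDeficient F B) : #F = #(shadow F B) + 1 := by
  classical
  obtain ⟨K, hK⟩ : F.Nonempty := card_pos.1 (pos_of_gt h.card_shadow_lt)
  have herase := h.hallCondition_of_ssubset (erase_ssubset hK) _ subset_rfl
  have hmono := card_le_card (shadow_mono (erase_subset K F) B)
  have hlt := h.card_shadow_lt
  rw [card_erase_of_mem hK] at herase
  omega

theorem deleteVertex_notMem_shadow (h : IsMinimalDeficient F B) (hK : K ∈ F) {b : Fin (n + 1)}
    (hb : b ∈ B K) : deleteVertex K b ∉ shadow F B := by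
  classical
  intro hmem
  have hsub := shadow_update_erase_subset F B K b
  rw [insert_eq_of_mem hmem] at hsub
  exact h.card_shadow_lt.not_ge <|
    (h.card_le_card_shadow F _ (weight_update_erase_lt hK hb)).trans (card_le_card hsub)

theorem exists_ne_deleteVertex_eq (h : IsMinimalDeficient F B) {p : Fin (n + 1)}
    (hp : ∀ K ∈ F, p ∉ B K) :
    ∃ K ∈ F, ∃ K' ∈ F, K ≠ K' ∧ deleteVertex K p = deleteVertex K' p :=
  exists_ne_map_eq_of_card_lt_of_maps_to h.card_shadow_lt fun _ hK =>
    deleteVertex_mem_shadow hK (hp _ hK)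

end IsMinimalDeficient

end Shadow

section Fibre

variable {n : ℕ}

open Classical in
/-- The members of `F` that extend `K` by a last vertex. -/
noncomputable def fibre (F : Finset (SimpleGraph (Fin (n + 1)))) (K : SimpleGraph (Fin n)) :
    Finset (SimpleGraph (Fin (n + 1))) :=
  {G ∈ F | deleteVertex G (Fin.last n) = K}

open Classical in
/-- The graphs that members of `F` induce on the set of all vertices but the last. -/
noncomputable def initialParts (F : Finset (SimpleGraph (Fin (n + 1)))) :
    Finset (SimpleGraph (Fin n)) :=
  F.image fun G => deleteVertex G (Fin.last n)

open Classical in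
/-- The essential coordinates of the last rows of the extensions of `K` in `F`: the vertices of `K`
whose deletion identifies two of these extensions. -/
noncomputable def essentialVertices (F : Finset (SimpleGraph (Fin (n + 1))))
    (K : SimpleGraph (Fin n)) : Finset (Fin n) :=
  {u | IsEssentialCoord lastRow (fibre F K) u}

variable {F : Finset (SimpleGraph (Fin (n + 1)))} {G : SimpleGraph (Fin (n + 1))}
  {K : SimpleGraph (Fin n)}

theorem mem_fibre : G ∈ fibre F K ↔ G ∈ F ∧ deleteVertex G (Fin.last n) = K := by
  simp [fibre]

theorem mem_initialParts :
    K ∈ initialParts F ↔ ∃ G ∈ F, deleteVertex G (Fin.last n) = K := by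
  simp [initialParts]

theorem mem_essentialVertices {u : Fin n} :
    u ∈ essentialVertices F K ↔ IsEssentialCoord lastRow (fibre F K) u := by
  simp [essentialVertices]

theorem deleteVertex_last_mem_initialParts (hG : G ∈ F) :
    deleteVertex G (Fin.last n) ∈ initialParts F :=
  mem_initialParts.2 ⟨G, hG, rfl⟩

theorem fibre_nonempty (hK : K ∈ initialParts F) : (fibre F K).Nonempty := by
  obtain ⟨G, hG, rfl⟩ := mem_initialParts.1 hK
  exact ⟨G, mem_fibre.2 ⟨hG, rfl⟩⟩

theorem eq_of_lastRow_eq_of_mem_fibre {H : SimpleGraph (Fin (n + 1))} (hG : G ∈ fibre F K)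
    (hH : H ∈ fibre F K) (h : lastRow G = lastRow H) : G = H :=
  eq_of_deleteVertex_last_eq ((mem_fibre.1 hG).2.trans (mem_fibre.1 hH).2.symm) h

theorem sum_card_fibre (F : Finset (SimpleGraph (Fin (n + 1)))) :
    ∑ K ∈ initialParts F, #(fibre F K) = #F := by
  classical
  exact (card_eq_sum_card_image _ F).symm

theorem sum_card_fibre_le (F : Finset (SimpleGraph (Fin (n + 1))))
    (X : Finset (SimpleGraph (Fin n))) : ∑ K ∈ X, #(fibre F K) ≤ #F := by
  classical
  exact (sum_card_fiberwise_eq_card_filter F X _).trans_le (card_filter_le _ _)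

theorem sum_weight_fibre {V : Type*} (F : Finset (SimpleGraph (Fin (n + 1))))
    (B : SimpleGraph (Fin (n + 1)) → Finset V) :
    ∑ K ∈ initialParts F, weight (fibre F K) B = weight F B := by
  classical
  exact sum_fiberwise_of_maps_to (fun _ hG => deleteVertex_last_mem_initialParts hG) _

theorem card_essentialVertices_lt (h : (fibre F K).Nonempty) :
    #(essentialVertices F K) < #(fibre F K) :=
  card_lt_card_of_isEssentialCoord h fun _ hu => mem_essentialVertices.1 hu

end Fibre

section Lift

variable {n : ℕ}

/-- The vertices of `K` that are forbidden in some extension of `K` in `F`. -/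
noncomputable def inheritedForbidden (F : Finset (SimpleGraph (Fin (n + 2))))
    (B : SimpleGraph (Fin (n + 2)) → Finset (Fin (n + 2))) (K : SimpleGraph (Fin (n + 1))) :
    Finset (Fin (n + 1)) :=
  (fibre F K).biUnion fun G => (B G).preimage Fin.castSucc (Fin.castSucc_injective _).injOn

/-- The vertices to be forbidden in `K` in order that every allowed deletion from `K` lifts
injectively to allowed deletions from the extensions of `K` in `F`. -/
noncomputable def inducedForbidden (F : Finset (SimpleGraph (Fin (n + 2))))
    (B : SimpleGraph (Fin (n + 2)) → Finset (Fin (n + 2))) (K : SimpleGraph (Fin (n + 1))) :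
    Finset (Fin (n + 1)) :=
  essentialVertices F K ∪ inheritedForbidden F B K

variable {F : Finset (SimpleGraph (Fin (n + 2)))}
  {B : SimpleGraph (Fin (n + 2)) → Finset (Fin (n + 2))} {G : SimpleGraph (Fin (n + 2))}
  {K : SimpleGraph (Fin (n + 1))} {u : Fin (n + 1)}

theorem mem_inheritedForbidden :
    u ∈ inheritedForbidden F B K ↔ ∃ G ∈ fibre F K, u.castSucc ∈ B G := by
  simp [inheritedForbidden]

theorem notMem_inducedForbidden :
    u ∉ inducedForbidden F B K ↔
      u ∉ essentialVertices F K ∧ ∀ G ∈ fibre F K, u.castSucc ∉ B G := by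
  simp [inducedForbidden, mem_inheritedForbidden]

theorem deleteVertex_castSucc_mem_fibre (hG : G ∈ fibre F K) (hu : u.castSucc ∉ B G) :
    deleteVertex G u.castSucc ∈ fibre (shadow F B) (deleteVertex K u) := by
  obtain ⟨hGF, rfl⟩ := mem_fibre.1 hG
  exact mem_fibre.2 ⟨deleteVertex_mem_shadow hGF hu, deleteVertex_castSucc_deleteVertex_last G u⟩

theorem card_fibre_le_card_fibre_shadow (hu : u ∉ inducedForbidden F B K) :
    #(fibre F K) ≤ #(fibre (shadow F B) (deleteVertex K u)) := by
  obtain ⟨hess, hB⟩ := notMem_inducedForbidden.1 hu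
  refine card_le_card_of_injOn (deleteVertex · u.castSucc)
    (fun G hG => deleteVertex_castSucc_mem_fibre hG (hB G hG)) fun G hG H hH hdel => ?_
  have hoff : ∀ i ≠ u, lastRow G i = lastRow H i := fun i hi =>
    propext (adj_iff_of_deleteVertex_eq hdel ((Fin.castSucc_injective _).ne hi)
      (Fin.castSucc_ne_last u).symm)
  have hat : lastRow G u = lastRow H u := by
    by_contra hne
    exact hess (mem_essentialVertices.2 ⟨G, hG, H, hH, hne, hoff⟩)
  refine eq_of_lastRow_eq_of_mem_fibre hG hH (funext fun i => ?_)
  rcases eq_or_ne i u with rfl | hi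
  · exact hat
  · exact hoff i hi

theorem mem_essentialVertices_shadow (hB : ∀ G ∈ fibre F K, u.castSucc ∉ B G) {x : Fin n}
    (hx : u.succAbove x ∈ essentialVertices F K) :
    x ∈ essentialVertices (shadow F B) (deleteVertex K u) := by
  obtain ⟨G, hG, H, hH, hne, hag⟩ := mem_essentialVertices.1 hx
  refine mem_essentialVertices.2 ⟨_, deleteVertex_castSucc_mem_fibre hG (hB G hG),
    _, deleteVertex_castSucc_mem_fibre hH (hB H hH), ?_, fun i hi => ?_⟩
  · simpa only [lastRow_deleteVertex_castSucc] using hne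
  · simpa only [lastRow_deleteVertex_castSucc] using
      hag _ (Fin.succAbove_right_injective.ne hi)

theorem erase_essentialVertices_subset (hB : ∀ G ∈ fibre F K, u.castSucc ∉ B G) :
    (essentialVertices F K).erase u ⊆
      (essentialVertices (shadow F B) (deleteVertex K u)).map u.succAboveEmb := by
  intro y hy
  obtain ⟨hyu, hy⟩ := mem_erase.1 hy
  obtain ⟨x, rfl⟩ := Fin.exists_succAbove_eq hyu
  exact mem_map_of_mem _ (mem_essentialVertices_shadow hB hy)

theorem card_essentialVertices_le_card_fibre_shadow (hK : (fibre F K).Nonempty)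
    (hB : ∀ G ∈ fibre F K, u.castSucc ∉ B G) :
    #(essentialVertices F K) ≤ #(fibre (shadow F B) (deleteVertex K u)) := by
  obtain ⟨G, hG⟩ := hK
  have hlt := card_essentialVertices_lt ⟨_, deleteVertex_castSucc_mem_fibre hG (hB G hG)⟩
  have hsub := card_le_card (erase_essentialVertices_subset hB)
  have herase := pred_card_le_card_erase (s := essentialVertices F K) (a := u)
  rw [card_map] at hsub
  omega

theorem sum_card_fibre_le_of_hallCondition {Y : Finset (SimpleGraph (Fin (n + 1)))}
    (hY : HallCondition Y (inducedForbidden F B)) :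
    ∑ K ∈ Y, #(fibre F K) ≤
      ∑ L ∈ shadow Y (inducedForbidden F B), #(fibre (shadow F B) L) := by
  classical
  refine sum_le_sum_biUnion_of_hall hY fun K _ L hL => ?_
  obtain ⟨u, hu, rfl⟩ := mem_image.1 hL
  exact card_fibre_le_card_fibre_shadow (mem_compl.1 hu)

theorem card_le_card_shadow_of_hallCondition
    (h : HallCondition (initialParts F) (inducedForbidden F B)) : #F ≤ #(shadow F B) := by
  rw [← sum_card_fibre F]
  exact (sum_card_fibre_le_of_hallCondition h).trans (sum_card_fibre_le _ _)

end Lift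

section Tight

variable {n : ℕ}

/-- The extensions of `K` in `F` have as many essential coordinates as Bondy's theorem allows, and
none of these, nor the last vertex, is forbidden in an extension: this is the equality case of
`card_inducedForbidden_lt_weight_fibre`. -/
structure IsTight (F : Finset (SimpleGraph (Fin (n + 2))))
    (B : SimpleGraph (Fin (n + 2)) → Finset (Fin (n + 2))) (K : SimpleGraph (Fin (n + 1))) :
    Prop where
  card_fibre : #(fibre F K) = #(essentialVertices F K) + 1
  castSucc_notMem : ∀ u ∈ essentialVertices F K, ∀ G ∈ fibre F K, u.castSucc ∉ B G
  last_notMem : ∀ G ∈ fibre F K, Fin.last (n + 1) ∉ B G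

variable {F : Finset (SimpleGraph (Fin (n + 2)))}
  {B : SimpleGraph (Fin (n + 2)) → Finset (Fin (n + 2))} {K : SimpleGraph (Fin (n + 1))}

theorem card_inheritedForbidden_le :
    #(inheritedForbidden F B K) ≤ ∑ G ∈ fibre F K, #((B G).erase (Fin.last (n + 1))) := by
  refine card_biUnion_le.trans (sum_le_sum fun G _ => ?_)
  refine card_le_card_of_injOn Fin.castSucc (fun u hu => ?_) (Fin.castSucc_injective _).injOn
  exact mem_erase.2 ⟨Fin.castSucc_ne_last u, mem_preimage.1 hu⟩

theorem card_inducedForbidden_lt_weight_fibre (hK : (fibre F K).Nonempty) :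
    #(inducedForbidden F B K) < weight (fibre F K) B := by
  have hess := card_essentialVertices_lt hK
  have hinh : #(inheritedForbidden F B K) ≤ ∑ G ∈ fibre F K, #(B G) :=
    card_inheritedForbidden_le.trans (sum_le_sum fun _ _ => card_erase_le)
  have hunion : #(inducedForbidden F B K) ≤ _ := card_union_le _ _
  rw [weight_eq]
  omega

theorem isTight_of_weight_fibre_le (hK : (fibre F K).Nonempty)
    (h : weight (fibre F K) B ≤ #(inducedForbidden F B K) + 1) : IsTight F B K := by
  have hess := card_essentialVertices_lt hK
  have hunion : #(inducedForbidden F B K) +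
      #(essentialVertices F K ∩ inheritedForbidden F B K) = _ := card_union_add_card_inter _ _
  have hinh := card_inheritedForbidden_le (F := F) (B := B) (K := K)
  have herase : ∑ G ∈ fibre F K, #((B G).erase (Fin.last (n + 1))) ≤ ∑ G ∈ fibre F K, #(B G) :=
    sum_le_sum fun _ _ => card_erase_le
  rw [weight_eq] at h
  refine ⟨by omega, fun u hu G hG hmem => ?_, fun G hG hmem => ?_⟩
  · have hpos : 0 < #(essentialVertices F K ∩ inheritedForbidden F B K) :=
      card_pos.2 ⟨u, mem_inter.2 ⟨hu, mem_inheritedForbidden.2 ⟨G, hG, hmem⟩⟩⟩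
    omega
  · have hlt : ∑ G ∈ fibre F K, #((B G).erase (Fin.last (n + 1))) < ∑ G ∈ fibre F K, #(B G) :=
      sum_lt_sum (fun _ _ => card_erase_le) ⟨G, hG, card_erase_lt_of_mem hmem⟩
    omega

theorem weight_initialParts_le (F : Finset (SimpleGraph (Fin (n + 2))))
    (B : SimpleGraph (Fin (n + 2)) → Finset (Fin (n + 2))) :
    weight (initialParts F) (inducedForbidden F B) ≤ weight F B := by
  rw [← sum_weight_fibre F B]
  exact sum_le_sum fun _ hK => card_inducedForbidden_lt_weight_fibre (fibre_nonempty hK)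

theorem isTight_of_weight_le (h : weight F B ≤ weight (initialParts F) (inducedForbidden F B))
    (hK : K ∈ initialParts F) : IsTight F B K := by
  have hle : ∀ K ∈ initialParts F, #(inducedForbidden F B K) + 1 ≤ weight (fibre F K) B :=
    fun _ hK => card_inducedForbidden_lt_weight_fibre (fibre_nonempty hK)
  have hsum : ∑ K ∈ initialParts F, (#(inducedForbidden F B K) + 1) =
      ∑ K ∈ initialParts F, weight (fibre F K) B :=
    ((weight_initialParts_le F B).antisymm h).trans (sum_weight_fibre F B).symm
  exact isTight_of_weight_fibre_le (fibre_nonempty hK)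
    ((sum_eq_sum_iff_of_le hle).1 hsum K hK).ge

end Tight

section TightlyDeficient

variable {n : ℕ}

/-- The configuration left over when allowed deletions from the initial parts of `F` cannot be
lifted to `F`: the initial parts only just fail Hall's condition, and all fibres over them are
tight. -/
structure IsTightlyDeficient (F : Finset (SimpleGraph (Fin (n + 2))))
    (B : SimpleGraph (Fin (n + 2)) → Finset (Fin (n + 2))) : Prop where
  card_shadow_lt : #(shadow F B) < #F
  isMinimalDeficient : IsMinimalDeficient (initialParts F) (inducedForbidden F B)
  isTight : ∀ K ∈ initialParts F, IsTight F B K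

/-- The allowed vertex-deleted subgraphs of the initial parts of `F`. -/
noncomputable abbrev initialShadow (F : Finset (SimpleGraph (Fin (n + 2))))
    (B : SimpleGraph (Fin (n + 2)) → Finset (Fin (n + 2))) : Finset (SimpleGraph (Fin n)) :=
  shadow (initialParts F) (inducedForbidden F B)

variable {F : Finset (SimpleGraph (Fin (n + 2)))}
  {B : SimpleGraph (Fin (n + 2)) → Finset (Fin (n + 2))} {K K' : SimpleGraph (Fin (n + 1))}
  {b b' : Fin (n + 1)}

namespace IsTightlyDeficient

theorem exists_one_lt_card_fibre (h : IsTightlyDeficient F B) :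
    ∃ K ∈ initialParts F, 1 < #(fibre F K) := by
  by_contra! hall
  refine h.card_shadow_lt.not_ge (card_le_card_of_injOn (deleteVertex · (Fin.last (n + 1)))
    (fun G hG => ?_) fun G hG H hH hdel => ?_)
  · have hK := deleteVertex_last_mem_initialParts hG
    exact deleteVertex_mem_shadow hG ((h.isTight _ hK).last_notMem G (mem_fibre.2 ⟨hG, rfl⟩))
  · have hK := deleteVertex_last_mem_initialParts hG
    exact card_le_one.1 (hall _ hK) G (mem_fibre.2 ⟨hG, rfl⟩) H (mem_fibre.2 ⟨hH, hdel.symm⟩)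

theorem card_le_sum_add_card_fibre (h : IsTightlyDeficient F B) (hK : K ∈ initialParts F) :
    #F ≤ ∑ L ∈ initialShadow F B, #(fibre (shadow F B) L) + #(fibre F K) := by
  classical
  have hlift := sum_card_fibre_le_of_hallCondition
    (h.isMinimalDeficient.hallCondition_of_ssubset (erase_ssubset hK))
  have hmono := sum_le_sum_of_subset (f := fun L => #(fibre (shadow F B) L))
    (shadow_mono (erase_subset K (initialParts F)) (inducedForbidden F B))
  rw [← sum_card_fibre F, ← sum_erase_add _ _ hK]
  exact Nat.add_le_add_right (hlift.trans hmono) _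

theorem deleteVertex_notMem_initialShadow (h : IsTightlyDeficient F B) (hK : K ∈ initialParts F)
    (hb : b ∈ essentialVertices F K) : deleteVertex K b ∉ initialShadow F B :=
  h.isMinimalDeficient.deleteVertex_notMem_shadow hK (mem_union_left _ hb)

theorem card_fibre_le_card_fibre_shadow_add_one (h : IsTightlyDeficient F B)
    (hK : K ∈ initialParts F) (hb : b ∈ essentialVertices F K) :
    #(fibre F K) ≤ #(fibre (shadow F B) (deleteVertex K b)) + 1 := by
  rw [(h.isTight K hK).card_fibre]
  exact Nat.add_le_add_right (card_essentialVertices_le_card_fibre_shadow (fibre_nonempty hK)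
    ((h.isTight K hK).castSucc_notMem b hb)) 1

theorem sum_add_card_fibre_le (h : IsTightlyDeficient F B) (hK : K ∈ initialParts F)
    (hb : b ∈ essentialVertices F K) :
    ∑ L ∈ initialShadow F B, #(fibre (shadow F B) L) + #(fibre F K) ≤ #F := by
  classical
  have hsum := sum_card_fibre_le (shadow F B) (insert (deleteVertex K b) (initialShadow F B))
  rw [sum_insert (h.deleteVertex_notMem_initialShadow hK hb)] at hsum
  have hfibre := h.card_fibre_le_card_fibre_shadow_add_one hK hb
  have hlt := h.card_shadow_lt
  omega

theorem card_fibre_le_card_fibre (h : IsTightlyDeficient F B) (hK : K ∈ initialParts F)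
    (hK' : K' ∈ initialParts F) : #(fibre F K) ≤ #(fibre F K') := by
  rcases (essentialVertices F K).eq_empty_or_nonempty with hempty | ⟨b, hb⟩
  · rw [(h.isTight K hK).card_fibre, hempty]
    exact (fibre_nonempty hK').card_pos
  · have hle := h.sum_add_card_fibre_le hK hb
    have hge := h.card_le_sum_add_card_fibre hK'
    omega

theorem card_fibre_eq_card_fibre (h : IsTightlyDeficient F B) (hK : K ∈ initialParts F)
    (hK' : K' ∈ initialParts F) : #(fibre F K) = #(fibre F K') :=
  (h.card_fibre_le_card_fibre hK hK').antisymm (h.card_fibre_le_card_fibre hK' hK)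

theorem one_lt_card_fibre (h : IsTightlyDeficient F B) (hK : K ∈ initialParts F) :
    1 < #(fibre F K) := by
  obtain ⟨K₀, hK₀, hlt⟩ := h.exists_one_lt_card_fibre
  rwa [h.card_fibre_eq_card_fibre hK hK₀]

theorem essentialVertices_nonempty (h : IsTightlyDeficient F B) (hK : K ∈ initialParts F) :
    (essentialVertices F K).Nonempty := by
  have hlt := h.one_lt_card_fibre hK
  rw [(h.isTight K hK).card_fibre] at hlt
  exact card_pos.1 (Nat.lt_of_succ_lt_succ hlt)

theorem card_eq_mul_add (h : IsTightlyDeficient F B) (hK : K ∈ initialParts F) :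
    #F = #(initialShadow F B) * #(fibre F K) + #(fibre F K) := by
  rw [← Nat.succ_mul, Nat.succ_eq_add_one, ← h.isMinimalDeficient.card_eq_card_shadow_add_one,
    ← sum_card_fibre F]
  exact sum_const_nat fun _ hK' => h.card_fibre_eq_card_fibre hK' hK

theorem sum_card_fibre_shadow_eq (h : IsTightlyDeficient F B) (hK : K ∈ initialParts F) :
    ∑ L ∈ initialShadow F B, #(fibre (shadow F B) L) = #(initialShadow F B) * #(fibre F K) := by
  obtain ⟨b, hb⟩ := h.essentialVertices_nonempty hK
  have hle := h.sum_add_card_fibre_le hK hb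
  have hge := h.card_le_sum_add_card_fibre hK
  have hcard := h.card_eq_mul_add hK
  omega

theorem card_fibre_shadow_eq (h : IsTightlyDeficient F B) (hK : K ∈ initialParts F)
    {L : SimpleGraph (Fin n)} (hL : L ∈ initialShadow F B) :
    #(fibre (shadow F B) L) = #(fibre F K) := by
  have hle : ∀ L ∈ initialShadow F B, #(fibre F K) ≤ #(fibre (shadow F B) L) := by
    intro L hL
    obtain ⟨K', hK', u, hu, rfl⟩ := mem_shadow.1 hL
    exact (h.card_fibre_eq_card_fibre hK hK').trans_le (card_fibre_le_card_fibre_shadow hu)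
  have hsum : ∑ _L ∈ initialShadow F B, #(fibre F K) =
      ∑ L ∈ initialShadow F B, #(fibre (shadow F B) L) := by
    rw [sum_const, smul_eq_mul, h.sum_card_fibre_shadow_eq hK]
  exact ((sum_eq_sum_iff_of_le hle).1 hsum L hL).symm

theorem deleteVertex_eq_deleteVertex (h : IsTightlyDeficient F B) (hK : K ∈ initialParts F)
    (hb : b ∈ essentialVertices F K) (hK' : K' ∈ initialParts F)
    (hb' : b' ∈ essentialVertices F K') : deleteVertex K b = deleteVertex K' b' := by
  classical
  by_contra hne
  have hsum := sum_card_fibre_le (shadow F B)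
    (insert (deleteVertex K b) (insert (deleteVertex K' b') (initialShadow F B)))
  rw [sum_insert (by simp [hne, h.deleteVertex_notMem_initialShadow hK hb]),
    sum_insert (h.deleteVertex_notMem_initialShadow hK' hb'), h.sum_card_fibre_shadow_eq hK] at hsum
  have hfibre := h.card_fibre_le_card_fibre_shadow_add_one hK hb
  have hfibre' := h.card_fibre_le_card_fibre_shadow_add_one hK' hb'
  have heq := h.card_fibre_eq_card_fibre hK hK'
  have hcard := h.card_eq_mul_add hK
  have hone := h.one_lt_card_fibre hK
  have hlt := h.card_shadow_lt
  omega

theorem essentialVertices_eq_map (h : IsTightlyDeficient F B) (hK : K ∈ initialParts F)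
    {p : Fin (n + 1)} (hp : p ∉ inducedForbidden F B K) :
    essentialVertices F K =
      (essentialVertices (shadow F B) (deleteVertex K p)).map p.succAboveEmb := by
  obtain ⟨hpess, hpB⟩ := notMem_inducedForbidden.1 hp
  have hsub := erase_essentialVertices_subset hpB
  rw [erase_eq_of_notMem hpess] at hsub
  refine eq_of_subset_of_card_le hsub ?_
  have hfibre := h.card_fibre_shadow_eq hK (deleteVertex_mem_shadow hK hp)
  have hlt : #(essentialVertices (shadow F B) (deleteVertex K p)) < _ :=
    card_essentialVertices_lt (card_pos.1 (hfibre ▸ (fibre_nonempty hK).card_pos))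
  rw [hfibre, (h.isTight K hK).card_fibre] at hlt
  rw [card_map]
  exact Nat.le_of_lt_succ hlt

theorem isEssentialCoord_edge (h : IsTightlyDeficient F B) {p : Fin (n + 1)}
    (hp : ∀ K ∈ initialParts F, p ∉ inducedForbidden F B K) :
    ∃ K ∈ initialParts F, ∃ c ∈ essentialVertices F K,
      IsEssentialCoord (fun G e => e ∈ SimpleGraph.edgeSet G) (initialParts F) s(p, c) := by
  obtain ⟨K, hK, K', hK', hne, hdel⟩ := h.isMinimalDeficient.exists_ne_deleteVertex_eq hp
  obtain ⟨c, hc⟩ := h.essentialVertices_nonempty hK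
  have hc' : c ∈ essentialVertices F K' := by
    rwa [h.essentialVertices_eq_map hK' (hp K' hK'), ← hdel,
      ← h.essentialVertices_eq_map hK (hp K hK)]
  have hpc : p ≠ c := fun hpc => (notMem_inducedForbidden.1 (hp K hK)).1 (hpc ▸ hc)
  have hoff : ∀ e ≠ s(p, c), (e ∈ K.edgeSet) = (e ∈ K'.edgeSet) := fun e he =>
    propext (mem_edgeSet_iff_of_deleteVertex_eq hpc hdel
      (h.deleteVertex_eq_deleteVertex hK hc hK' hc') he)
  refine ⟨K, hK, c, hc, K, hK, K', hK', fun hat => hne ?_, hoff⟩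
  refine SimpleGraph.edgeSet_injective (Set.ext fun e => ?_)
  rcases eq_or_ne e s(p, c) with rfl | he
  · exact iff_of_eq hat
  · exact iff_of_eq (hoff e he)

theorem card_compl_biUnion_lt (h : IsTightlyDeficient F B) :
    #((initialParts F).biUnion (inducedForbidden F B))ᶜ < #(initialParts F) := by
  have hnonempty : (initialParts F).Nonempty :=
    card_pos.1 (pos_of_gt h.isMinimalDeficient.card_shadow_lt)
  refine card_lt_card_of_isEssentialCoord_edge (α := fun _ => Prop)
    (f := fun G e => e ∈ SimpleGraph.edgeSet G) hnonempty fun p hp => ?_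
  simp only [mem_compl, mem_biUnion, not_exists, not_and] at hp
  obtain ⟨K, hK, c, hc, hess⟩ := h.isEssentialCoord_edge hp
  refine ⟨c, ?_, hess⟩
  rw [mem_compl, not_not]
  exact mem_biUnion.2 ⟨K, hK, mem_union_left _ hc⟩

theorem lt_weight (h : IsTightlyDeficient F B) :
    n + 1 < weight (initialParts F) (inducedForbidden F B) := by
  by_contra! hle
  exact h.card_compl_biUnion_lt.not_ge
    (card_le_card_compl_biUnion_of_weight_le (hle.trans_eq (Fintype.card_fin _).symm))

end IsTightlyDeficient

end TightlyDeficient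

theorem card_le_card_shadow {n : ℕ} {F : Finset (SimpleGraph (Fin (n + 1)))}
    {B : SimpleGraph (Fin (n + 1)) → Finset (Fin (n + 1))} (h : weight F B ≤ n) :
    #F ≤ #(shadow F B) := by
  induction n with
  | zero =>
    rw [weight_eq] at h
    omega
  | succ n ih =>
    by_contra! hlt
    have hnot : ¬ HallCondition (initialParts F) (inducedForbidden F B) := fun hHall =>
      hlt.not_ge (card_le_card_shadow_of_hallCondition hHall)
    have hle := weight_initialParts_le F B
    have hgt : n < weight (initialParts F) (inducedForbidden F B) := by
      by_contra! hn
      exact hnot fun Y hY => ih ((sum_le_sum_of_subset hY).trans hn)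
    have hmin : IsMinimalDeficient (initialParts F) (inducedForbidden F B) :=
      .of_not_hallCondition hnot fun Y C hYC => ih (by omega)
    have hdef : IsTightlyDeficient F B :=
      ⟨hlt, hmin, fun K hK => isTight_of_weight_le (by omega) hK⟩
    exact hdef.lt_weight.not_ge (hle.trans h)

section Speed

variable {P : Set OrderedGraph} {n : ℕ}

theorem IsHereditary.deleteVertex_mem_level (hP : IsHereditary P)
    {G : SimpleGraph (Fin (n + 1))} (hG : G ∈ level P (n + 1)) (v : Fin (n + 1)) :
    deleteVertex G v ∈ level P n :=
  hP hG ⟨Fin.succAboveOrderEmb v, fun _ _ => Iff.rfl⟩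

theorem IsHereditary.card_le_speed (hP : IsHereditary P)
    {F : Finset (SimpleGraph (Fin (n + 1)))} (hF : ↑F ⊆ level P (n + 1)) (hn : #F ≤ n) :
    #F ≤ speed P n := by
  have hsub : ↑(shadow F fun _ => ∅) ⊆ level P n := by
    intro S hS
    obtain ⟨G, hG, v, -, rfl⟩ := mem_shadow.1 (mem_coe.1 hS)
    exact hP.deleteVertex_mem_level (hF hG) v
  calc #F ≤ #(shadow F fun _ => ∅) := card_le_card_shadow (by simpa [weight] using hn)
    _ ≤ speed P n := by
      rw [← Set.ncard_coe_finset]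
      exact Set.ncard_le_ncard hsub

theorem IsHereditary.speed_succ_le (hP : IsHereditary P) (hn : speed P n < n) :
    speed P (n + 1) ≤ speed P n := by
  by_contra! hlt
  obtain ⟨T, hT, hcard⟩ := Set.exists_subset_card_eq (Nat.succ_le_of_lt hlt)
  lift T to Finset (SimpleGraph (Fin (n + 1))) using T.toFinite
  rw [Set.ncard_coe_finset] at hcard
  have hle := hP.card_le_speed hT (hcard.trans_le hn)
  omega

theorem IsHereditary.speed_lt (hP : IsHereditary P) {k : ℕ} (hk : speed P k < k) (hkn : k ≤ n) :
    speed P n < n := by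
  induction n, hkn using Nat.le_induction with
  | base => exact hk
  | succ n _ ih => exact (hP.speed_succ_le ih).trans_lt (ih.trans n.lt_succ_self)

end Speed

end OrderedGraph

theorem theorem2_general (P : Set OrderedGraph) (hP : OrderedGraph.IsHereditary P) (k : ℕ)
    (hlt : OrderedGraph.speed P k < k) : AntitoneOn (OrderedGraph.speed P) (Set.Ici k) :=
  antitoneOn_nat_Ici_of_succ_le fun _ hn => hP.speed_succ_le (hP.speed_lt hlt hn)

theorem theorem2 (P : Set OrderedGraph) (hP : OrderedGraph.IsHereditary P)
    (k : ℕ) (hk : 136 ≤ k) (hlt : OrderedGraph.speed P k < k) :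
    (∀ n : ℕ, k ≤ n → OrderedGraph.speed P n ≤ OrderedGraph.speed P k) ∧
      AntitoneOn (OrderedGraph.speed P) (Set.Ici k) :=
  have h := theorem2_general P hP k hlt
  ⟨fun _ hn => h Set.self_mem_Ici hn hn, h⟩
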